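/- For $d\ge 1$ and $P,S\subseteq\mathbb{R}^d$ let $C_i(P)$ denote the set of $i$-th coordinates of points of $P$. We say that $S$ contains $P$ if there are functions $f_i:C_i(P)\to C_i(S)$ $(1\le i\le d)$ such that $\frac{f_i(x)-f_i(x')}{x-x'}\ge 1$ for all $i$ and all $x,x'\in C_i(P)$ with $x>x'$, and $(f_1(x_1),\dots,f_d(x_d))\in S$ for all $(x_1,\dots,x_d)\in P$; otherwise $S$ is $P$-free. For real $n>0$ let $\mathrm{px}(n,P,d)$ be the supremum of the $d$-dimensional Lebesgue measure of $S$ over all open $P$-free sets $S\subseteq[0,n]^d$, and write $\mathrm{px}(n,P)=\mathrm{px}(n,P,2)$ for $P\subseteq\mathbb{R}^2$. For $P\subseteq\mathbb{R}^2$, an integer $t\ge 2$ and a real $c>0$ let $$Q_{P,t,c}=\{(x_1,x_2,y): (x_1,x_2)\in P,\ y\in\{c,2c,\dots,tc\}\}\subseteq\mathbb{R}^3 .$$ Let $c>0$ be real and let $P\subseteq\mathbb{R}^2$ satisfy $\mathrm{px}(n,P)=O(n)$ as $n\to\infty$. (1) If $P$ has at least two points, then $\mathrm{px}(n,Q_{P,2,c},3)=\Theta(n^{5/2})$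 as $n\to\infty$. (2) If $P$ contains three points with pairwise distinct $x$-coordinates, then $\mathrm{px}(n,Q_{P,3,c},3)=\Theta(n^{8/3})$ as $n\to\infty$. Here $n$ ranges over the positive reals, and the implied constants may depend on $P$ and $c$. -/

import Mathlib

open Filter Asymptotics MeasureTheory

noncomputable section

namespace PointPattern

/-- The set of all `i`-th coordinates of points of `P ⊆ ℝ^d`. -/
def coordSet {d : ℕ} (P : Set (Fin d → ℝ)) (i : Fin d) : Set ℝ :=
  {a : ℝ | ∃ p ∈ P, p i = a}

/-- `S` contains `P`: there are maps `f i` from the `i`-th coordinates of `P` to the `i`-th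
coordinates of `S`, all of whose difference quotients are at least `1`, such that applying
them coordinatewise sends `P` into `S`. (Only the values of `f i` on `coordSet P i` matter.) -/
def Contains {d : ℕ} (S P : Set (Fin d → ℝ)) : Prop :=
  ∃ f : Fin d → ℝ → ℝ,
    (∀ i, Set.MapsTo (f i) (coordSet P i) (coordSet S i)) ∧
    (∀ i, ∀ x ∈ coordSet P i, ∀ x' ∈ coordSet P i, x' < x →
      1 ≤ (f i x - f i x') / (x - x')) ∧
    (∀ p ∈ P, (fun i => f i (p i)) ∈ S)

/-- `S` is `P`-free. -/
def Avoids {d : ℕ} (S P : Set (Fin d → ℝ)) : Prop := ¬ Contains S P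

/-- The extremal function `px(n, P, d)`: the supremum of the Lebesgue measures of the open
`P`-free subsets of `[0, n]^d`. (These measures all lie between `0` and `n ^ d`.) -/
def px {d : ℕ} (n : ℝ) (P : Set (Fin d → ℝ)) : ℝ :=
  sSup {v : ℝ | ∃ S : Set (Fin d → ℝ), IsOpen S ∧
    S ⊆ Set.Icc (fun _ => 0) (fun _ => n) ∧ Avoids S P ∧ v = (volume S).toReal}

/-- The measures over which the supremum `px n P` is taken are bounded. -/
theorem px_bddAbove {d : ℕ} (n : ℝ) (P : Set (Fin d → ℝ)) :
    BddAbove {v : ℝ | ∃ S : Set (Fin d → ℝ), IsOpen S ∧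
      S ⊆ Set.Icc (fun _ => 0) (fun _ => n) ∧ Avoids S P ∧ v = (volume S).toReal} := by
  refine ⟨(volume (Set.Icc (fun _ : Fin d => (0 : ℝ)) (fun _ => n))).toReal, ?_⟩
  rintro v ⟨S, -, hS, -, rfl⟩
  exact ENNReal.toReal_mono isCompact_Icc.measure_lt_top.ne (measure_mono hS)

/-- The stack `Q_{P, t, c} = {(x, y) : x ∈ P, y ∈ {c, 2c, …, tc}} ⊆ ℝ^{d+1}` of `t` copies
of `P ⊆ ℝ^d`; the last coordinate is the stacking direction. -/
def stack {d : ℕ} (P : Set (Fin d → ℝ)) (t : ℕ) (c : ℝ) : Set (Fin (d + 1) → ℝ) :=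
  {z | (fun i : Fin d => z i.castSucc) ∈ P ∧
    ∃ j : ℕ, 1 ≤ j ∧ j ≤ t ∧ z (Fin.last d) = (j : ℝ) * c}

end PointPattern

end

namespace PointPattern

/-! Both parts are the case `t = 2`, `3` of the exponent `3 - 1/t`, the Kővári–Sós–Turán exponent `2
- 1/t` plus one for a free direction.

Upper bound: among the slices of a stack-free set at heights `u + k * c`, any `t` meet in a `P`-free
set, of measure `O(n)`. A Kővári–Sós–Turán count over the `O(n)` slices bounds their total measure
(`sum_measure_le_of_inter_le`); integrating over `u` in `[0, c)` gives `px_stack_le`.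

Lower bound: take a `K_{t,t}`-free bipartite graph on `m + m` vertices with order `m ^ (2 - 1/t)`
edges, `m` of order `n`. Turn each edge into a box, thin in one direction of the plane and in the
stacking direction, and of full length `n` in the third (`le_px_stack`). A copy of the stack would
trace out a `K_{t,t}`. The graphs are point-line incidences for `t = 2` and a norm graph over `F_p`
for `t = 3`. -/

/-! ### Upper bound: counting over parallel slices. -/

theorem natCast_le_add_mul_choose {a : ℝ} (ha : 0 < a) {t : ℕ} (ht : 1 ≤ t) (r : ℕ) :
    (r : ℝ) ≤ a + t + (t.factorial : ℝ) / a ^ (t - 1) * (r.choose t : ℝ) := by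
  by_cases hr : (r : ℝ) ≤ a + t
  · have : 0 ≤ (t.factorial : ℝ) / a ^ (t - 1) * (r.choose t : ℝ) := by positivity
    linarith
  · push Not at hr
    have htr : t ≤ r := by
      have : (t : ℝ) ≤ r := by linarith
      exact_mod_cast this
    -- All `t` factors of the falling factorial are at least `r + 1 - t`, which exceeds `a`; trading
    -- `t - 1` of them for `a` leaves a bound linear in `r`.
    have h1 : (((r + 1 - t : ℕ) ^ t : ℕ) : ℝ) ≤ t.factorial * r.choose t := by
      exact_mod_cast Nat.pow_sub_le_descFactorial r t |>.trans
        (Nat.descFactorial_eq_factorial_mul_choose r t).le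
    set s : ℕ := r + 1 - t with hs
    have hs' : (s : ℝ) = r + 1 - t := by
      rw [hs, Nat.cast_sub (by omega)]; push_cast; ring
    have h2 : a ^ (t - 1) * s ≤ t.factorial * r.choose t := by
      refine le_trans ?_ h1
      push_cast
      obtain ⟨k, rfl⟩ : ∃ k, t = k + 1 := ⟨t - 1, by omega⟩
      rw [pow_succ, Nat.add_sub_cancel]
      gcongr
      linarith
    have h3 : (s : ℝ) ≤ (t.factorial : ℝ) / a ^ (t - 1) * (r.choose t : ℝ) := by
      rw [div_mul_eq_mul_div, le_div_iff₀ (by positivity)]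
      linarith
    linarith

/-- A family of sets all of whose `t`-fold intersections are small has small total measure. -/
theorem sum_measure_le_of_inter_le {X : Type*} [MeasurableSpace X] (μ : Measure X)
    {D : Set X} {A : ℕ → Set X} (hA : ∀ k, MeasurableSet (A k)) (hAD : ∀ k, A k ⊆ D)
    {t M : ℕ} (ht : 1 ≤ t) {a : ℝ} (ha : 0 < a) {W : ENNReal}
    (hW : ∀ K ∈ (Finset.range M).powersetCard t, μ (⋂ k ∈ K, A k) ≤ W) :
    ∑ k ∈ Finset.range M, μ (A k) ≤ ENNReal.ofReal (a + t) * μ D +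
      ENNReal.ofReal ((t.factorial : ℝ) / a ^ (t - 1)) * (M.choose t * W) := by
  classical
  set b : ℝ := (t.factorial : ℝ) / a ^ (t - 1) with hb
  have hb0 : 0 ≤ b := by positivity
  have hI : ∀ K : Finset ℕ, MeasurableSet (⋂ k ∈ K, A k) := fun K =>
    Finset.measurableSet_biInter K fun k _ => hA k
  have hpt : ∀ x ∈ D, ∑ k ∈ Finset.range M, (A k).indicator (1 : X → ENNReal) x ≤
      ENNReal.ofReal (a + t) + ENNReal.ofReal b *
        ∑ K ∈ (Finset.range M).powersetCard t, (⋂ k ∈ K, A k).indicator (1 : X → ENNReal) x := by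
    intro x _
    -- A point lying in exactly `r` of the sets lies in `r.choose t` of the `t`-fold intersections,
    -- so the numerical inequality applies pointwise.
    set R := (Finset.range M).filter (fun k => x ∈ A k) with hR
    have h1 : ∑ k ∈ Finset.range M, (A k).indicator (1 : X → ENNReal) x = (R.card : ENNReal) := by
      simp [Set.indicator_apply, hR]
    have h2 : ∑ K ∈ (Finset.range M).powersetCard t,
        (⋂ k ∈ K, A k).indicator (1 : X → ENNReal) x = (R.card.choose t : ENNReal) := by
      rw [← Finset.card_powersetCard]
      simp only [Set.indicator_apply, Pi.one_apply, Finset.sum_boole]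
      congr 2
      ext K
      simp only [Finset.mem_filter, Finset.mem_powersetCard, Set.mem_iInter, hR]
      constructor
      · rintro ⟨⟨h, h'⟩, h''⟩
        exact ⟨fun k hk => Finset.mem_filter.2 ⟨h hk, h'' k hk⟩, h'⟩
      · rintro ⟨h, h'⟩
        exact ⟨⟨fun k hk => (Finset.mem_filter.1 (h hk)).1, h'⟩,
          fun k hk => (Finset.mem_filter.1 (h hk)).2⟩
    rw [h1, h2, ← ENNReal.ofReal_natCast R.card, ← ENNReal.ofReal_natCast (R.card.choose t),
      ← ENNReal.ofReal_mul hb0, ← ENNReal.ofReal_add (by positivity) (by positivity)]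
    exact ENNReal.ofReal_le_ofReal (natCast_le_add_mul_choose ha ht _)
  have hleft : ∑ k ∈ Finset.range M, μ (A k) =
      ∫⁻ x in D, ∑ k ∈ Finset.range M, (A k).indicator (1 : X → ENNReal) x ∂μ := by
    rw [lintegral_finsetSum _ fun k _ => measurable_one.indicator (hA k)]
    refine Finset.sum_congr rfl fun k _ => ?_
    rw [lintegral_indicator_one (hA k), Measure.restrict_apply (hA k),
      Set.inter_eq_left.2 (hAD k)]
  rw [hleft]
  have hm : Measurable fun x => ∑ K ∈ (Finset.range M).powersetCard t,
      (⋂ k ∈ K, A k).indicator (1 : X → ENNReal) x :=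
    Finset.measurable_fun_sum _ fun K _ => measurable_one.indicator (hI K)
  refine (setLIntegral_mono (by fun_prop) hpt).trans ?_
  rw [lintegral_add_left measurable_const, setLIntegral_const, lintegral_const_mul _ hm,
    lintegral_finsetSum _ fun K _ => measurable_one.indicator (hI K)]
  gcongr
  calc _ ≤ ∑ K ∈ (Finset.range M).powersetCard t, W := by
        refine Finset.sum_le_sum fun K hK => ?_
        rw [lintegral_indicator_one (hI K)]
        exact (Measure.restrict_apply_le _ _).trans (hW K hK)
    _ = _ := by simp

/-- The horizontal slice of `S ⊆ ℝ^{d+1}` at height `y`. -/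
def slice {d : ℕ} (S : Set (Fin (d + 1) → ℝ)) (y : ℝ) : Set (Fin d → ℝ) :=
  {x | (Fin.snoc x y : Fin (d + 1) → ℝ) ∈ S}

theorem isOpen_slice {d : ℕ} {S : Set (Fin (d + 1) → ℝ)} (hS : IsOpen S) (y : ℝ) :
    IsOpen (slice S y) := by
  refine hS.preimage (continuous_pi fun i => ?_)
  refine Fin.lastCases ?_ (fun j => ?_) i
  · simpa using continuous_const
  · simpa using continuous_apply j

theorem slice_subset {d : ℕ} {S : Set (Fin (d + 1) → ℝ)} {n : ℝ}
    (hS : S ⊆ Set.Icc (fun _ => 0) (fun _ => n)) (y : ℝ) :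
    slice S y ⊆ Set.Icc (fun _ => 0) (fun _ => n) := by
  intro x hx
  have h := hS hx
  refine ⟨fun i => ?_, fun i => ?_⟩
  · simpa using h.1 i.castSucc
  · simpa using h.2 i.castSucc

theorem volume_eq_lintegral_slice {d : ℕ} {S : Set (Fin (d + 1) → ℝ)} (hS : MeasurableSet S) :
    volume S = ∫⁻ y, volume (slice S y) := by
  have h := volume_preserving_piFinSuccAbove (fun _ : Fin (d + 1) => ℝ) (Fin.last d)
  have h' := h.symm
  rw [← h'.measure_preimage hS.nullMeasurableSet]
  rw [Measure.volume_eq_prod, Measure.prod_apply ((MeasurableEquiv.measurable _) hS)]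
  congr 1 with y
  congr 1
  ext x
  simp [slice, MeasurableEquiv.piFinSuccAbove, Fin.insertNthEquiv]

/-- A common copy of `P` in `t` slices at heights separated by `c` yields a copy of the stack. -/
theorem contains_stack_of_contains_inter {d : ℕ} {P : Set (Fin d → ℝ)}
    {S : Set (Fin (d + 1) → ℝ)} {t : ℕ} {c : ℝ} (hc : 0 < c) (u : ℝ) {K : Finset ℕ}
    (hK : K.card = t) (h : Contains (⋂ k ∈ K, slice S (u + k * c)) P) :
    Contains S (stack P t c) := by
  classical
  obtain ⟨f, -, hf, hfP⟩ := h
  let e : Fin t ↪o ℕ := K.orderEmbOfFin hK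
  -- The levels go to the chosen slices in increasing order; the value `0` off the levels plays no
  -- role.
  let g : ℝ → ℝ := fun y => if hj : ∃ j : Fin t, y = ((j : ℕ) + 1 : ℝ) * c then
    u + (e hj.choose : ℝ) * c else 0
  have hg : ∀ j : Fin t, g (((j : ℕ) + 1 : ℝ) * c) = u + (e j : ℝ) * c := by
    intro j
    have hj : ∃ j' : Fin t, ((j : ℕ) + 1 : ℝ) * c = ((j' : ℕ) + 1 : ℝ) * c := ⟨j, rfl⟩
    have : hj.choose = j := by
      have h := hj.choose_spec
      have h2 := mul_right_cancel₀ hc.ne' h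
      apply Fin.ext
      have h3 : ((j : ℕ) : ℝ) = ((hj.choose : Fin t) : ℕ) := by linarith
      exact_mod_cast h3.symm
    simp only [g]
    rw [dif_pos hj, this]
  have hlev : ∀ z ∈ stack P t c, ∃ j : Fin t, z (Fin.last d) = ((j : ℕ) + 1 : ℝ) * c := by
    rintro z ⟨-, j, hj1, hjt, hz⟩
    refine ⟨⟨j - 1, by omega⟩, ?_⟩
    rw [hz, Nat.cast_sub hj1]; push_cast; ring
  have key : ∀ z ∈ stack P t c,
      (fun i => (Fin.snoc f g : Fin (d + 1) → ℝ → ℝ) i (z i)) ∈ S := by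
    intro z hz
    obtain ⟨j, hj⟩ := hlev z hz
    have h1 := Set.mem_iInter₂.1 (hfP _ hz.1) (e j) (Finset.orderEmbOfFin_mem K hK j)
    have h2 : (fun i => (Fin.snoc f g : Fin (d + 1) → ℝ → ℝ) i (z i)) =
        (Fin.snoc (fun i : Fin d => f i (z i.castSucc)) (u + (e j : ℝ) * c) :
          Fin (d + 1) → ℝ) := by
      ext i
      refine Fin.lastCases ?_ (fun i => ?_) i
      · simp [hj, hg]
      · simp
    rw [h2]
    exact h1
  refine ⟨Fin.snoc f g, ?_, ?_, key⟩
  · rintro i _ ⟨z, hz, rfl⟩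
    exact ⟨_, key z hz, rfl⟩
  · intro i
    refine Fin.lastCases ?_ (fun i => ?_) i
    · rintro _ ⟨z, hz, rfl⟩ _ ⟨z', hz', rfl⟩ hlt
      obtain ⟨j, hj⟩ := hlev z hz
      obtain ⟨j', hj'⟩ := hlev z' hz'
      rw [hj, hj'] at hlt ⊢
      rw [le_div_iff₀ (by linarith)]
      simp only [Fin.snoc_last, hg]
      have hjj : j' < j := by
        have h1 := lt_of_mul_lt_mul_right hlt hc.le
        have h2 : ((j' : ℕ) : ℝ) < (j : ℕ) := by linarith
        exact_mod_cast h2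
      -- A strictly increasing integer sequence gains at least one per step, so gaps between levels
      -- do not shrink.
      have hcard : ∀ m : ℕ, ∀ hm : (j' : ℕ) + m < t, e j' + m ≤ e ⟨j' + m, hm⟩ := by
        intro m
        induction m with
        | zero => intro hm; exact le_rfl
        | succ m ih =>
          intro hm
          have h1 := ih (by omega)
          have h2 : e ⟨j' + m, by omega⟩ < e ⟨j' + (m + 1), hm⟩ :=
            e.strictMono (Fin.mk_lt_mk.2 (by omega))
          omega
      have h1 := hcard (j - j') (by have := j.2; omega)
      have h2 : (⟨j' + (j - j' : ℕ), by have := j.2; omega⟩ : Fin t) = j :=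
        Fin.ext (by have : (j' : ℕ) < j := hjj; simp; omega)
      rw [h2] at h1
      have h3 : e j' + (j : ℕ) ≤ e j + j' := by
        have : (j' : ℕ) < j := hjj
        omega
      have h4 : (e j' : ℝ) + (j : ℕ) ≤ e j + (j' : ℕ) := by exact_mod_cast h3
      nlinarith
    · rintro _ ⟨z, hz, rfl⟩ _ ⟨z', hz', rfl⟩ hlt
      have := hf i (z i.castSucc) ⟨_, hz.1, rfl⟩ (z' i.castSucc) ⟨_, hz'.1, rfl⟩ hlt
      simpa using this

theorem px_nonneg {d : ℕ} (n : ℝ) (P : Set (Fin d → ℝ)) : 0 ≤ px n P := by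
  refine Real.sSup_nonneg ?_
  rintro v ⟨S, -, -, -, rfl⟩
  exact ENNReal.toReal_nonneg

theorem volume_le_px {d : ℕ} {n : ℝ} {P S : Set (Fin d → ℝ)} (hS : IsOpen S)
    (hSn : S ⊆ Set.Icc (fun _ => 0) (fun _ => n)) (hSP : Avoids S P) :
    volume S ≤ ENNReal.ofReal (px n P) := by
  have hfin : volume S ≠ ⊤ :=
    ((measure_mono hSn).trans_lt isCompact_Icc.measure_lt_top).ne
  rw [← ENNReal.ofReal_toReal hfin]
  exact ENNReal.ofReal_le_ofReal (le_csSup (px_bddAbove n P) ⟨S, hS, hSn, hSP, rfl⟩)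

theorem isOpen_biInter_slice {d : ℕ} {S : Set (Fin (d + 1) → ℝ)} (hS : IsOpen S) (K : Finset ℕ)
    (y : ℕ → ℝ) : IsOpen (⋂ k ∈ K, slice S (y k)) :=
  isOpen_biInter_finset fun k _ => isOpen_slice hS (y k)

/-- Heights are folded modulo `c`: the volume is the integral over `u` in `[0, c)` of the total
measure of the slices at `u + k * c`, to which the counting bound applies. The parameter `a` is left
free for later optimisation. -/
theorem px_stack_le {d : ℕ} (P : Set (Fin d → ℝ)) {t : ℕ} (ht : 1 ≤ t) {c : ℝ} (hc : 0 < c)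
    {n : ℝ} (hn : 0 ≤ n) {a : ℝ} (ha : 0 < a) :
    px n (stack P t c) ≤ c * ((a + t) * n ^ d +
      t.factorial / a ^ (t - 1) * ((n / c + 1) ^ t * px n P)) := by
  have hpx := px_nonneg n P
  have hbound : 0 ≤ c * ((a + t) * n ^ d +
      t.factorial / a ^ (t - 1) * ((n / c + 1) ^ t * px n P)) := by positivity
  refine Real.sSup_le ?_ hbound
  rintro v ⟨S, hS, hSn, hSP, rfl⟩
  refine ENNReal.toReal_le_of_le_ofReal hbound ?_
  set M : ℕ := ⌊n / c⌋₊ + 1 with hM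
  have hslice : ∀ u : ℝ, ∑ k ∈ Finset.range M, volume (slice S (u + k * c)) ≤
      ENNReal.ofReal ((a + t) * n ^ d +
        t.factorial / a ^ (t - 1) * ((n / c + 1) ^ t * px n P)) := by
    intro u
    refine (sum_measure_le_of_inter_le volume (D := Set.Icc (fun _ => 0) (fun _ => n))
      (A := fun k : ℕ => slice S (u + k * c)) (W := ENNReal.ofReal (px n P))
      (fun k => (isOpen_slice hS _).measurableSet) (fun k => slice_subset hSn _) ht ha ?_).trans ?_
    · intro K hK
      rw [Finset.mem_powersetCard] at hK
      refine volume_le_px (isOpen_biInter_slice hS K _) ?_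
        fun h => hSP (contains_stack_of_contains_inter hc u hK.2 h)
      obtain ⟨k, hk⟩ : K.Nonempty := Finset.card_pos.1 (by omega)
      exact (Set.biInter_subset_of_mem hk).trans (slice_subset hSn _)
    · rw [Real.volume_Icc_pi, Finset.prod_const, Finset.card_univ, Fintype.card_fin, sub_zero,
        ← ENNReal.ofReal_pow hn, ← ENNReal.ofReal_mul (by positivity),
        ← ENNReal.ofReal_natCast, ← ENNReal.ofReal_mul (by positivity),
        ← ENNReal.ofReal_mul (by positivity), ← ENNReal.ofReal_add (by positivity) (by positivity)]
      refine ENNReal.ofReal_le_ofReal ?_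
      gcongr
      refine le_trans (b := (M : ℝ) ^ t) (by exact_mod_cast Nat.choose_le_pow M t) ?_
      gcongr
      rw [hM]; push_cast
      gcongr
      exact Nat.floor_le (by positivity)
  rw [volume_eq_lintegral_slice hS.measurableSet, ENNReal.ofReal_mul hc.le]
  have hsupp : ∀ y, y ∉ ⋃ k ∈ Finset.range M, Set.Ico ((k : ℝ) * c) ((k : ℝ) * c + c) →
      volume (slice S y) = 0 := by
    intro y hy
    suffices slice S y = ∅ by simp [this]
    rw [Set.eq_empty_iff_forall_notMem]
    intro x hx
    apply hy
    have h := hSn hx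
    have h0 : 0 ≤ y := by simpa using h.1 (Fin.last d)
    have h1 : y ≤ n := by simpa using h.2 (Fin.last d)
    simp only [Set.mem_iUnion, Finset.mem_range]
    refine ⟨⌊y / c⌋₊, ?_, ?_, ?_⟩
    · rw [hM, Nat.lt_succ_iff]
      exact Nat.floor_le_floor (by gcongr)
    · have := Nat.floor_le (a := y / c) (by positivity)
      rwa [le_div_iff₀ hc] at this
    · have := Nat.lt_floor_add_one (y / c)
      rw [div_lt_iff₀ hc] at this
      linarith
  have hmeas : Measurable fun y => volume (slice S y) := by
    have h : MeasurableSet {z : ℝ × (Fin d → ℝ) | (Fin.snoc z.2 z.1 : Fin (d + 1) → ℝ) ∈ S} := by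
      refine (hS.preimage (continuous_pi fun i => ?_)).measurableSet
      refine Fin.lastCases ?_ (fun j => ?_) i
      · simpa using continuous_fst
      · simpa using (by fun_prop : Continuous fun a : ℝ × (Fin d → ℝ) => a.2 j)
    exact measurable_measure_prodMk_left h
  calc ∫⁻ y, volume (slice S y)
      ≤ ∫⁻ y, ∑ k ∈ Finset.range M, (Set.Ico ((k : ℝ) * c) ((k : ℝ) * c + c)).indicator
          (fun y => volume (slice S y)) y := by
        refine lintegral_mono fun y => ?_
        by_cases hy : y ∈ ⋃ k ∈ Finset.range M, Set.Ico ((k : ℝ) * c) ((k : ℝ) * c + c)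
        · simp only [Set.mem_iUnion] at hy
          obtain ⟨k, hk, hyk⟩ := hy
          refine le_trans ?_ (Finset.single_le_sum (fun _ _ => zero_le) hk)
          rw [Set.indicator_of_mem hyk]
        · rw [hsupp y hy]
          exact zero_le
    _ = ∑ k ∈ Finset.range M, ∫⁻ y in Set.Ico ((k : ℝ) * c) ((k : ℝ) * c + c),
          volume (slice S y) := by
        rw [lintegral_finsetSum _ fun k _ => hmeas.indicator measurableSet_Ico]
        exact Finset.sum_congr rfl fun k _ => lintegral_indicator measurableSet_Ico _
    _ = ∑ k ∈ Finset.range M, ∫⁻ u in Set.Ico 0 c, volume (slice S (u + k * c)) := by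
        refine Finset.sum_congr rfl fun k _ => ?_
        rw [← (measurePreserving_add_right volume ((k : ℝ) * c)).setLIntegral_comp_preimage
          measurableSet_Ico hmeas]
        congr 2
        ext u
        simp [add_comm]
    _ = ∫⁻ u in Set.Ico 0 c, ∑ k ∈ Finset.range M, volume (slice S (u + k * c)) := by
        rw [lintegral_finsetSum]
        intro k _
        exact hmeas.comp (by fun_prop)
    _ ≤ ∫⁻ u in Set.Ico 0 c, ENNReal.ofReal ((a + t) * n ^ d +
        t.factorial / a ^ (t - 1) * ((n / c + 1) ^ t * px n P)) :=
        lintegral_mono fun u => hslice u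
    _ = _ := by rw [setLIntegral_const, Real.volume_Ico, sub_zero, mul_comm]

theorem isBigO_px_stack {P : Set (Fin 2 → ℝ)} {c : ℝ} (hc : 0 < c)
    (hP : (fun n : ℝ => px n P) =O[atTop] (fun n : ℝ => n)) {t : ℕ} (ht : 1 ≤ t) :
    (fun n : ℝ => px n (stack P t c)) =O[atTop] (fun n : ℝ => n ^ (3 - 1 / t : ℝ)) := by
  obtain ⟨C, hC0, hC⟩ := hP.exists_pos
  rw [IsBigOWith] at hC
  refine IsBigO.of_bound (c * ((1 + t) + t.factorial * (2 / c) ^ t * C)) ?_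
  filter_upwards [hC, eventually_ge_atTop 1, eventually_ge_atTop c] with n hn h1 hcn
  have hn0 : 0 < n := by linarith
  rw [Real.norm_of_nonneg (px_nonneg _ _), Real.norm_of_nonneg hn0.le] at hn
  rw [Real.norm_of_nonneg (px_nonneg _ _), Real.norm_of_nonneg (by positivity)]
  have ht' : (1 : ℝ) ≤ t := by exact_mod_cast ht
  have htinv : (1 : ℝ) / t ≤ 1 := by rw [div_le_one (by linarith)]; exact ht'
  -- This `a` balances the terms `a * n ^ 2` and `n ^ (t + 1) / a ^ (t - 1)`.
  have h := px_stack_le P ht hc hn0.le (a := n ^ (1 - 1 / t : ℝ)) (by positivity)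
  refine h.trans ?_
  rw [mul_assoc]
  refine mul_le_mul_of_nonneg_left ?_ hc.le
  rw [add_mul (1 + (t : ℝ))]
  refine add_le_add ?_ ?_
  · rw [add_mul, add_mul, one_mul]
    gcongr
    · rw [← Real.rpow_natCast n 2, ← Real.rpow_add hn0]
      refine le_of_eq ?_
      congr 1
      push_cast; ring
    · rw [← Real.rpow_natCast n 2]
      refine Real.rpow_le_rpow_of_exponent_le h1 ?_
      push_cast
      linarith
  · have hpx := px_nonneg n P
    have hb : n / c + 1 ≤ 2 / c * n := by
      have : 1 ≤ n / c := by rwa [le_div_iff₀ hc, one_mul]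
      have h2 : 2 / c * n = n / c + n / c := by ring
      linarith
    calc _ ≤ t.factorial / (n ^ (1 - 1 / t : ℝ)) ^ (t - 1) * ((2 / c * n) ^ t * (C * n)) := by
          gcongr
      _ = t.factorial * (2 / c) ^ t * C * (n ^ t * n / (n ^ (1 - 1 / t : ℝ)) ^ (t - 1)) := by
          rw [mul_pow]; ring
      _ = _ := by
          congr 1
          rw [← Real.rpow_natCast (n ^ (1 - 1 / t : ℝ)), ← Real.rpow_mul hn0.le,
            ← Real.rpow_natCast n t, ← Real.rpow_add_one hn0.ne', ← Real.rpow_sub hn0]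
          congr 1
          rw [Nat.cast_sub ht]
          field_simp
          push_cast
          ring

/-! ### Dense `K_{t,t}`-free graphs over finite fields. -/

/-- `V × V`-bipartite graphs without a complete bipartite subgraph `K_{t,t}`. -/
def BicliqueFree {V : Type*} (t : ℕ) (r : V → V → Prop) : Prop :=
  ∀ a b : Fin t → V, Function.Injective a → Function.Injective b → ¬ ∀ i j, r (a i) (b j)

/-- Two distinct non-vertical lines share at most one point; `a` is the line (slope, intercept), `b`
the point. -/
theorem bicliqueFree_two_line {F : Type*} [Field F] :
    BicliqueFree 2 fun a b : F × F => b.2 = a.1 * b.1 + a.2 := by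
  intro a b ha hb h
  have h00 : (b 0).2 = (a 0).1 * (b 0).1 + (a 0).2 := h 0 0
  have h01 : (b 1).2 = (a 0).1 * (b 1).1 + (a 0).2 := h 0 1
  have h10 : (b 0).2 = (a 1).1 * (b 0).1 + (a 1).2 := h 1 0
  have h11 : (b 1).2 = (a 1).1 * (b 1).1 + (a 1).2 := h 1 1
  have hprod : ((a 0).1 - (a 1).1) * ((b 0).1 - (b 1).1) = 0 := by
    linear_combination (-1 : F) * h00 + h01 + h10 - h11
  rcases mul_eq_zero.1 hprod with h' | h'
  · have h1 : (a 0).1 = (a 1).1 := sub_eq_zero.1 h'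
    have h2 : (a 0).2 = (a 1).2 := by
      rw [h1] at h00; linear_combination h10 - h00
    exact absurd (ha (Prod.ext h1 h2)) (by decide)
  · have h1 : (b 0).1 = (b 1).1 := sub_eq_zero.1 h'
    have h2 : (b 0).2 = (b 1).2 := by rw [h00, h01, h1]
    exact absurd (hb (Prod.ext h1 h2)) (by decide)

/-- Adjacency in the projective norm graph of `F[√d]` over `F`. -/
def NormAdj {F : Type*} [Field F] (d : F) (a b : F × F × F) : Prop :=
  (a.1 - b.1) ^ 2 - d * (a.2.1 - b.2.1) ^ 2 = a.2.2 * b.2.2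

theorem NormAdj.symm {F : Type*} [Field F] {d : F} {a b : F × F × F} (h : NormAdj d a b) :
    NormAdj d b a := by
  unfold NormAdj at *
  linear_combination h

theorem eq_zero_of_sq_eq_mul_sq {F : Type*} [Field F] {d : F} (hd : ¬ IsSquare d) {x y : F}
    (h : x ^ 2 - d * y ^ 2 = 0) : x = 0 ∧ y = 0 := by
  by_cases hy : y = 0
  · subst hy
    simpa using h
  · refine absurd ⟨x / y, ?_⟩ hd
    field_simp
    linear_combination -h

/-- Two pairs of vectors of `F³` that are orthogonal to each other cannot both be linearly
independent. -/
theorem not_linearIndependent_of_dotProduct_eq_zero {F : Type*} [Field F] {u v u' v' : Fin 3 → F}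
    (h1 : u ⬝ᵥ u' = 0) (h2 : u ⬝ᵥ v' = 0) (h3 : v ⬝ᵥ u' = 0) (h4 : v ⬝ᵥ v' = 0)
    (hu : LinearIndependent F ![u, v]) : ¬ LinearIndependent F ![u', v'] := by
  have hw := crossProduct_ne_zero_iff_linearIndependent.2 hu
  rw [← crossProduct_ne_zero_iff_linearIndependent, not_not]
  have key : ∀ x : Fin 3 → F, u ⬝ᵥ x = 0 → v ⬝ᵥ x = 0 → ∃ a : F, a • crossProduct u v = x := by
    intro x hux hvx
    by_contra! h
    refine crossProduct_ne_zero_iff_linearIndependent.2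
      ((LinearIndependent.pair_iff' hw).2 h) ?_
    rw [cross_cross_eq_smul_sub_smul, hux, hvx]
    simp
  obtain ⟨a, rfl⟩ := key u' h1 h3
  obtain ⟨b, rfl⟩ := key v' h2 h4
  simp

/-- Along a line, adjacency to a fixed `b` is a quadratic equation whose leading coefficient is the
norm of the first two coordinates of the direction. Three roots `0`, `1`, `s` kill that norm, so by
anisotropy the line is vertical, and then all its points have only one possible common neighbour. -/
theorem NormAdj.false_of_collinear {F : Type*} [Field F] {d : F} (hd : ¬ IsSquare d)
    {a b : Fin 3 → F × F × F} (ha : Function.Injective a) (hb : Function.Injective b)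
    (h : ∀ i j, NormAdj d (a i) (b j)) {s : F} (hs : s • (a 1 - a 0) = a 2 - a 0) : False := by
  have e1 : s * ((a 1).1 - (a 0).1) = (a 2).1 - (a 0).1 := congrArg (fun z => z.1) hs
  have e2 : s * ((a 1).2.1 - (a 0).2.1) = (a 2).2.1 - (a 0).2.1 := congrArg (fun z => z.2.1) hs
  have e3 : s * ((a 1).2.2 - (a 0).2.2) = (a 2).2.2 - (a 0).2.2 := congrArg (fun z => z.2.2) hs
  have hq : s * (s - 1) * (((a 1).1 - (a 0).1) ^ 2 - d * ((a 1).2.1 - (a 0).2.1) ^ 2) = 0 := by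
    have h0 := h 0 0
    have h1 := h 1 0
    have h2 := h 2 0
    unfold NormAdj at h0 h1 h2
    have f1 : (a 2).1 = (a 0).1 + s * ((a 1).1 - (a 0).1) := by rw [e1]; ring
    have f2 : (a 2).2.1 = (a 0).2.1 + s * ((a 1).2.1 - (a 0).2.1) := by rw [e2]; ring
    have f3 : (a 2).2.2 = (a 0).2.2 + s * ((a 1).2.2 - (a 0).2.2) := by rw [e3]; ring
    rw [f1, f2, f3] at h2
    linear_combination h2 - s * h1 - (1 - s) * h0
  rcases mul_eq_zero.1 hq with hs' | hq
  · rcases mul_eq_zero.1 hs' with rfl | hs'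
    · rw [zero_smul, eq_comm, sub_eq_zero] at hs
      exact absurd (ha hs) (by decide)
    · rw [sub_eq_zero.1 hs', one_smul, sub_left_inj] at hs
      exact absurd (ha hs) (by decide)
  obtain ⟨g1, g2⟩ := eq_zero_of_sq_eq_mul_sq hd hq
  have hz : (a 1).2.2 - (a 0).2.2 ≠ 0 := fun g3 => absurd
    (ha (Prod.ext (sub_eq_zero.1 g1) (Prod.ext (sub_eq_zero.1 g2) (sub_eq_zero.1 g3)))) (by decide)
  have hb' : ∀ j, b j = ((a 0).1, (a 0).2.1, 0) := by
    intro j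
    have h0 := h 0 j
    have h1 := h 1 j
    unfold NormAdj at h0 h1
    rw [sub_eq_zero.1 g1, sub_eq_zero.1 g2] at h1
    have hw : (b j).2.2 = 0 := by
      refine (mul_eq_zero.1 (?_ : ((a 1).2.2 - (a 0).2.2) * (b j).2.2 = 0)).resolve_left hz
      linear_combination h0 - h1
    rw [hw, mul_zero] at h0
    obtain ⟨k1, k2⟩ := eq_zero_of_sq_eq_mul_sq hd h0
    exact Prod.ext (sub_eq_zero.1 k1).symm (Prod.ext (sub_eq_zero.1 k2).symm hw)
  exact absurd (hb ((hb' 0).trans (hb' 1).symm)) (by decide)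

theorem bicliqueFree_three_normAdj {F : Type*} [Field F] (h2 : (2 : F) ≠ 0) {d : F}
    (hd : ¬ IsSquare d) : BicliqueFree 3 (NormAdj d) := by
  intro a b ha hb h
  have hd0 : d ≠ 0 := fun h0 => hd (h0 ▸ IsSquare.zero)
  -- Mixed second differences of the adjacency equation leave only its bilinear part, so the
  -- differences `u` of the `a i` are orthogonal to the rescaled differences `v` of the `b j`. In
  -- `F³` one of the two pairs must then be dependent: three collinear vertices on one side.
  let u : Fin 3 → Fin 3 → F := fun i =>
    ![(a i).1 - (a 0).1, (a i).2.1 - (a 0).2.1, (a i).2.2 - (a 0).2.2]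
  let v : Fin 3 → Fin 3 → F := fun i =>
    ![2 * ((b i).1 - (b 0).1), -(2 * d * ((b i).2.1 - (b 0).2.1)), (b i).2.2 - (b 0).2.2]
  have huv : ∀ i j, u i ⬝ᵥ v j = 0 := by
    intro i j
    have h00 := h 0 0
    have h01 := h 0 j
    have h10 := h i 0
    have h11 := h i j
    unfold NormAdj at h00 h01 h10 h11
    simp only [u, v, Matrix.vec3_dotProduct, Matrix.cons_val]
    linear_combination h01 + h10 - h00 - h11
  have hu0 : u 1 ≠ 0 := by
    intro h0
    refine absurd (ha (a₁ := 1) (a₂ := 0) ?_) (by decide)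
    have e0 := congrFun h0 0
    have e1 := congrFun h0 1
    have e2 := congrFun h0 2
    simp only [u, Matrix.cons_val, Pi.zero_apply, sub_eq_zero] at e0 e1 e2
    exact Prod.ext e0 (Prod.ext e1 e2)
  have hv0 : v 1 ≠ 0 := by
    intro h0
    refine absurd (hb (a₁ := 1) (a₂ := 0) ?_) (by decide)
    have e0 := congrFun h0 0
    have e1 := congrFun h0 1
    have e2 := congrFun h0 2
    simp [v, h2, hd0, sub_eq_zero] at e0 e1 e2
    exact Prod.ext e0 (Prod.ext e1 e2)
  by_cases hli : LinearIndependent F ![u 1, u 2]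
  · have hli' := not_linearIndependent_of_dotProduct_eq_zero (huv 1 1) (huv 1 2) (huv 2 1)
      (huv 2 2) hli
    rw [LinearIndependent.pair_iff' hv0] at hli'
    push Not at hli'
    obtain ⟨s, hs⟩ := hli'
    refine NormAdj.false_of_collinear hd hb ha (fun i j => (h j i).symm) (s := s) ?_
    have e0 := congrFun hs 0
    have e1 := congrFun hs 1
    have e2 := congrFun hs 2
    simp only [v, Matrix.cons_val, Pi.smul_apply, smul_eq_mul] at e0 e1 e2
    refine Prod.ext ?_ (Prod.ext ?_ e2)
    · exact mul_left_cancel₀ h2 (by simpa [mul_left_comm] using e0)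
    · exact mul_left_cancel₀ (mul_ne_zero h2 hd0) (by
        simp only [Prod.snd_sub, Prod.fst_sub, Prod.smul_fst, Prod.smul_snd, smul_eq_mul]
        linear_combination -e1)
  · rw [LinearIndependent.pair_iff' hu0] at hli
    push Not at hli
    obtain ⟨s, hs⟩ := hli
    refine NormAdj.false_of_collinear hd ha hb h (s := s) ?_
    have e0 := congrFun hs 0
    have e1 := congrFun hs 1
    have e2 := congrFun hs 2
    simp only [u, Matrix.cons_val, Pi.smul_apply, smul_eq_mul] at e0 e1 e2
    exact Prod.ext e0 (Prod.ext e1 e2)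

/-- For every odd prime `p` there is a relation on `Fin (p ^ t)` with at least `p ^ (2 t - 1) / 2`
pairs and no `K_{t,t}`. -/
def HasDenseBicliqueFree (t : ℕ) : Prop :=
  ∀ p : ℕ, p.Prime → 2 < p → ∃ G : Finset (Fin (p ^ t) × Fin (p ^ t)),
    BicliqueFree t (fun i j => (i, j) ∈ G) ∧ p ^ (2 * t - 1) ≤ 2 * G.card

/-- A `K_{t,t}`-free relation with a large set of parametrised edges can be moved to `Fin m`. -/
theorem exists_finset_of_bicliqueFree {V E : Type*} [Fintype V] [Fintype E] {t m : ℕ}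
    (hm : Fintype.card V = m) {r : V → V → Prop} (hr : BicliqueFree t r) (f : E → V × V)
    (hf : Function.Injective f) (hfr : ∀ e, r (f e).1 (f e).2) :
    ∃ G : Finset (Fin m × Fin m), BicliqueFree t (fun i j => (i, j) ∈ G) ∧
      Fintype.card E = G.card := by
  classical
  let φ := Fintype.equivFinOfCardEq hm
  refine ⟨Finset.univ.map ⟨fun e => (φ (f e).1, φ (f e).2), ?_⟩, ?_, by simp⟩
  · intro e e' h
    simp only [Prod.mk.injEq, φ.injective.eq_iff] at h
    exact hf (Prod.ext h.1 h.2)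
  · intro a b ha hb h
    refine hr (φ.symm ∘ a) (φ.symm ∘ b) (φ.symm.injective.comp ha) (φ.symm.injective.comp hb) ?_
    intro i j
    obtain ⟨e, -, he⟩ := Finset.mem_map.1 (h i j)
    have h1 : φ (f e).1 = a i := congrArg Prod.fst he
    have h2 : φ (f e).2 = b j := congrArg Prod.snd he
    simp only [Function.comp, ← h1, ← h2, Equiv.symm_apply_apply]
    exact hfr e

theorem hasDenseBicliqueFree_two : HasDenseBicliqueFree 2 := by
  intro p hp _
  have := Fact.mk hp
  obtain ⟨G, hG, hcard⟩ := exists_finset_of_bicliqueFree (V := ZMod p × ZMod p)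
    (E := ZMod p × ZMod p × ZMod p) (m := p ^ 2) (by simp [ZMod.card, sq])
    bicliqueFree_two_line (fun e => ((e.1, e.2.1), (e.2.2, e.1 * e.2.2 + e.2.1))) (by
      rintro ⟨x, y, z⟩ ⟨x', y', z'⟩ h
      simp only [Prod.mk.injEq] at h ⊢
      tauto) (fun e => rfl)
  refine ⟨G, hG, ?_⟩
  rw [← hcard]
  simp only [Fintype.card_prod, ZMod.card]
  calc p ^ (2 * 2 - 1) = p * (p * p) := by ring
    _ ≤ _ := by omega

theorem hasDenseBicliqueFree_three : HasDenseBicliqueFree 3 := by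
  intro p hp h2p
  have := Fact.mk hp
  have : Fact (2 < p) := ⟨h2p⟩
  have h2 : (2 : ZMod p) ≠ 0 := Ring.two_ne_zero (by rw [ZMod.ringChar_zmod_n]; omega)
  obtain ⟨d, hd⟩ := FiniteField.exists_nonsquare (F := ZMod p) (by
    rw [ZMod.ringChar_zmod_n]; omega)
  -- Edges whose left vertex has nonzero last coordinate: that coordinate and the four planar ones
  -- determine the rest, giving `p ^ 4 * (p - 1)` edges.
  obtain ⟨G, hG, hcard⟩ := exists_finset_of_bicliqueFree (V := ZMod p × ZMod p × ZMod p)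
    (E := (ZMod p × ZMod p) × (ZMod p × ZMod p) × (ZMod p)ˣ) (m := p ^ 3)
    (by simp [ZMod.card]; ring) (bicliqueFree_three_normAdj h2 hd)
    (fun e => ((e.1.1, e.1.2, (e.2.2 : ZMod p)), (e.2.1.1, e.2.1.2,
      ((e.1.1 - e.2.1.1) ^ 2 - d * (e.1.2 - e.2.1.2) ^ 2) / e.2.2))) (by
      rintro ⟨⟨x, y⟩, ⟨x', y'⟩, z⟩ ⟨⟨x1, y1⟩, ⟨x1', y1'⟩, z1⟩ h
      simp only [Prod.mk.injEq, Units.val_inj] at h ⊢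
      tauto) (fun e => by
      simp only [NormAdj]
      rw [mul_div_cancel₀]
      exact e.2.2.ne_zero)
  refine ⟨G, hG, ?_⟩
  rw [← hcard]
  simp only [Fintype.card_prod, ZMod.card, ZMod.card_units_eq_totient, Nat.totient_prime hp]
  calc p ^ (2 * 3 - 1) = p * p * (p * p * p) := by ring
    _ ≤ p * p * (p * p * (2 * (p - 1))) := by gcongr; omega
    _ = _ := by ring

/-! ### Lower bound: boxes indexed by the edges of a graph. -/

theorem abs_sub_le_of_one_le_div {X : Set ℝ} {f : ℝ → ℝ}
    (hf : ∀ x ∈ X, ∀ x' ∈ X, x' < x → 1 ≤ (f x - f x') / (x - x')) {x x' : ℝ}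
    (hx : x ∈ X) (hx' : x' ∈ X) : |x - x'| ≤ |f x - f x'| := by
  rcases lt_trichotomy x x' with h | rfl | h
  · have := hf x' hx' x hx h
    rw [le_div_iff₀ (by linarith), one_mul] at this
    rw [abs_sub_comm x, abs_sub_comm (f x), abs_of_pos (sub_pos.2 h)]
    exact this.trans (le_abs_self _)
  · simp
  · have := hf x hx x' hx' h
    rw [le_div_iff₀ (by linarith), one_mul] at this
    rw [abs_of_pos (sub_pos.2 h)]
    exact this.trans (le_abs_self _)

/-- The `a`-th open interval of length `s`. -/
def cell (s : ℝ) (a : ℕ) : Set ℝ := Set.Ioo (a * s) ((a + 1) * s)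

theorem abs_sub_lt_of_mem_cell {s : ℝ} {a : ℕ} {u v : ℝ} (hu : u ∈ cell s a) (hv : v ∈ cell s a) :
    |u - v| < s := by
  obtain ⟨h1, h2⟩ := hu
  obtain ⟨h3, h4⟩ := hv
  rw [abs_sub_lt_iff]
  constructor <;> linarith

theorem eq_of_mem_cell {s : ℝ} (hs : 0 < s) {a b : ℕ} {u : ℝ} (ha : u ∈ cell s a)
    (hb : u ∈ cell s b) : a = b := by
  have h1 := lt_of_mul_lt_mul_right (ha.1.trans hb.2) hs.le
  have h2 := lt_of_mul_lt_mul_right (hb.1.trans ha.2) hs.le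
  have h3 : a < b + 1 := by exact_mod_cast h1
  have h4 : b < a + 1 := by exact_mod_cast h2
  omega

/-- The box in `[0, n]³` over the cells `a` (in direction `k`) and `b` (in the last direction). -/
def cellBox (n s : ℝ) (k : Fin 2) (a b : ℕ) : Set (Fin 3 → ℝ) :=
  Set.univ.pi fun l => if l = k.castSucc then cell s a else
    if l = Fin.last 2 then cell s b else Set.Ioo 0 n

theorem cellBox_fst {n s : ℝ} {k : Fin 2} {a b : ℕ} {z : Fin 3 → ℝ} (hz : z ∈ cellBox n s k a b) :
    z k.castSucc ∈ cell s a := by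
  simpa using hz k.castSucc trivial

theorem cellBox_snd {n s : ℝ} {k : Fin 2} {a b : ℕ} {z : Fin 3 → ℝ} (hz : z ∈ cellBox n s k a b) :
    z (Fin.last 2) ∈ cell s b := by
  have h := hz (Fin.last 2) trivial
  beta_reduce at h
  rwa [if_neg (Fin.castSucc_lt_last k).ne', if_pos rfl] at h

theorem isOpen_cellBox (n s : ℝ) (k : Fin 2) (a b : ℕ) : IsOpen (cellBox n s k a b) := by
  refine isOpen_set_pi Set.finite_univ fun l _ => ?_
  unfold cell
  split_ifs <;> exact isOpen_Ioo

theorem cell_subset {n s : ℝ} (hs : 0 < s) {a m : ℕ} (ha : a < m) (hm : m * s ≤ n) :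
    cell s a ⊆ Set.Icc 0 n := by
  rintro u ⟨h1, h2⟩
  have h3 : ((a : ℝ) + 1) * s ≤ m * s := by
    gcongr
    exact_mod_cast ha
  exact ⟨by have : 0 ≤ (a : ℝ) * s := by positivity
            linarith, by linarith⟩

theorem cellBox_subset {n s : ℝ} (hs : 0 < s) (k : Fin 2) {a b m : ℕ} (ha : a < m) (hb : b < m)
    (hm : m * s ≤ n) : cellBox n s k a b ⊆ Set.Icc (fun _ => 0) (fun _ => n) := by
  intro z hz
  have h : ∀ l, z l ∈ Set.Icc 0 n := by
    intro l
    have h1 := hz l trivial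
    dsimp only at h1
    split_ifs at h1
    · exact cell_subset hs ha hm h1
    · exact cell_subset hs hb hm h1
    · exact Set.Ioo_subset_Icc_self h1
  exact ⟨fun l => (h l).1, fun l => (h l).2⟩

theorem volume_cellBox {n s : ℝ} (hs : 0 < s) (k : Fin 2) (a b : ℕ) :
    volume (cellBox n s k a b) = ENNReal.ofReal (s ^ 2 * n) := by
  have hcell : ∀ a : ℕ, volume (cell s a) = ENNReal.ofReal s := by
    intro a
    rw [cell, Real.volume_Ioo]
    congr 1
    ring
  rw [cellBox, volume_pi_pi, Fin.prod_univ_three]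
  rw [ENNReal.ofReal_mul (by positivity), ENNReal.ofReal_pow hs.le]
  fin_cases k
  · simp [hcell, Fin.ext_iff]
    ring
  · simp [hcell, Fin.ext_iff]
    ring

/-- The maps of a copy do not shrink distances, so the `t` values in direction `k` and the `t`
levels, all at least `s` apart, fall into distinct cells of length `s`. As the copy lies in the
union of boxes, these cells span a `K_{t,t}` in `G`. -/
theorem le_px_stack {P : Set (Fin 2 → ℝ)} {t : ℕ} (ht : 1 ≤ t) {c s n : ℝ} (hs : 0 < s)
    (hsc : s ≤ c) {x : Fin t → Fin 2 → ℝ} (hx : ∀ i, x i ∈ P) (k : Fin 2)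
    (hsx : ∀ i j, i ≠ j → s ≤ |x i k - x j k|) {m : ℕ} (hm : m * s ≤ n)
    {G : Finset (Fin m × Fin m)} (hG : BicliqueFree t fun i j => (i, j) ∈ G) :
    s ^ 2 * n * G.card ≤ px n (stack P t c) := by
  have hn : 0 ≤ n := le_trans (by positivity) hm
  refine le_csSup (px_bddAbove _ _) ⟨⋃ g ∈ G, cellBox n s k g.1 g.2, ?_, ?_, ?_, ?_⟩
  · exact isOpen_biUnion fun g _ => isOpen_cellBox _ _ _ _ _
  · exact Set.iUnion₂_subset fun g _ => cellBox_subset hs k g.1.2 g.2.2 hm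
  · rintro ⟨f, -, hf, hfP⟩
    have hstack : ∀ i j : Fin t, (Fin.snoc (x i) (((j + 1 : ℕ) : ℝ) * c) : Fin 3 → ℝ) ∈
        stack P t c := by
      intro i j
      refine ⟨by simpa using hx i, j + 1, by omega, by omega, Fin.snoc_last (α := fun _ => ℝ) _ _⟩
    have hmem : ∀ i j : Fin t, ∃ g ∈ G, f k.castSucc (x i k) ∈ cell s (g.1 : ℕ) ∧
        f (Fin.last 2) (((j + 1 : ℕ) : ℝ) * c) ∈ cell s (g.2 : ℕ) := by
      intro i j
      obtain ⟨g, hg, hz⟩ := Set.mem_iUnion₂.1 (hfP _ (hstack i j))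
      refine ⟨g, hg, ?_, ?_⟩
      · simpa only [Fin.snoc_castSucc] using cellBox_fst hz
      · simpa only [Fin.snoc_last] using cellBox_snd hz
    choose g hgG hg1 hg2 using hmem
    let o : Fin t := ⟨0, by omega⟩
    refine hG (fun i => (g i o).1) (fun j => (g o j).2) ?_ ?_ ?_
    · intro i i' hii
      by_contra hne
      have h1 := hg1 i o
      have h2 := hg1 i' o
      simp only at hii
      rw [← hii] at h2
      refine (abs_sub_lt_of_mem_cell h1 h2).not_ge ((hsx i i' hne).trans ?_)
      exact abs_sub_le_of_one_le_div (hf k.castSucc)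
        ⟨_, hstack i o, Fin.snoc_castSucc (α := fun _ => ℝ) _ _ _⟩
        ⟨_, hstack i' o, Fin.snoc_castSucc (α := fun _ => ℝ) _ _ _⟩
    · intro j j' hjj
      by_contra hne
      have h1 := hg2 o j
      have h2 := hg2 o j'
      simp only at hjj
      rw [← hjj] at h2
      refine (abs_sub_lt_of_mem_cell h1 h2).not_ge (hsc.trans (le_trans ?_
        (abs_sub_le_of_one_le_div (hf (Fin.last 2))
          ⟨_, hstack o j, Fin.snoc_last (α := fun _ => ℝ) _ _⟩
          ⟨_, hstack o j', Fin.snoc_last (α := fun _ => ℝ) _ _⟩)))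
      rw [← sub_mul, abs_mul, abs_of_pos (hs.trans_le hsc)]
      refine le_mul_of_one_le_left (hs.trans_le hsc).le ?_
      have h3 : ((j : ℕ) : ℤ) - (j' : ℕ) ≠ 0 := by
        intro h
        exact hne (Fin.ext (by omega))
      have h4 : (1 : ℝ) ≤ |(((j : ℕ) : ℤ) - (j' : ℕ) : ℤ)| := by
        exact_mod_cast Int.one_le_abs h3
      refine h4.trans_eq ?_
      push_cast
      congr 1
      ring
    · intro i j
      -- The image in direction `k` depends on `i` alone and the height on `j` alone, so the
      -- reference index `o` loses nothing.
      have h1 : (g i o).1 = (g i j).1 := Fin.ext (eq_of_mem_cell hs (hg1 i o) (hg1 i j))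
      have h2 : (g o j).2 = (g i j).2 := Fin.ext (eq_of_mem_cell hs (hg2 o j) (hg2 i j))
      simp only [h1, h2]
      exact hgG i j
  · rw [measure_biUnion_finset ?_ fun g _ => (isOpen_cellBox _ _ _ _ _).measurableSet]
    · simp only [volume_cellBox hs, Finset.sum_const, nsmul_eq_mul, ENNReal.toReal_mul,
        ENNReal.toReal_natCast]
      rw [ENNReal.toReal_ofReal (by positivity), mul_comm]
    · intro g _ g' _ hne
      refine Set.disjoint_left.2 fun z hz hz' => hne ?_
      exact Prod.ext (Fin.ext (eq_of_mem_cell hs (cellBox_fst hz) (cellBox_fst hz')))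
        (Fin.ext (eq_of_mem_cell hs (cellBox_snd hz) (cellBox_snd hz')))

theorem isBigO_rpow_px_stack {P : Set (Fin 2 → ℝ)} {c : ℝ} (hc : 0 < c) {t : ℕ} (ht : 1 ≤ t)
    (hG : HasDenseBicliqueFree t) {x : Fin t → Fin 2 → ℝ} (hx : ∀ i, x i ∈ P) (k : Fin 2)
    (hxk : Function.Injective fun i => x i k) :
    (fun n : ℝ => n ^ (3 - 1 / t : ℝ)) =O[atTop] (fun n : ℝ => px n (stack P t c)) := by
  obtain ⟨s, hsc, hsx, hs⟩ : ∃ s : ℝ, s ≤ c ∧ (∀ i j, i ≠ j → s ≤ |x i k - x j k|) ∧ 0 < s := by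
    have h1 : ∀ δ : ℝ, 0 < δ → ∀ᶠ s in nhdsWithin (0 : ℝ) (Set.Ioi 0), s ≤ δ := fun δ hδ =>
      nhdsWithin_le_nhds (eventually_le_nhds hδ)
    have h2 : ∀ᶠ s in nhdsWithin (0 : ℝ) (Set.Ioi 0), ∀ i j, i ≠ j → s ≤ |x i k - x j k| := by
      refine eventually_all.2 fun i => eventually_all.2 fun j => ?_
      by_cases hij : i = j
      · simp [hij]
      · filter_upwards [h1 _ (abs_pos.2 (sub_ne_zero.2 (hxk.ne hij)))] with s hs _ using hs
    exact ((h1 c hc).and (h2.and self_mem_nhdsWithin)).exists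
  have ht0 : (0 : ℝ) < t := by exact_mod_cast ht
  refine IsBigO.of_bound (s ^ (2 - 1 / t : ℝ) * 2 ^ (2 * t) / s ^ 2) ?_
  have hlim : Tendsto (fun n : ℝ => (n / s) ^ (1 / t : ℝ)) atTop atTop :=
    (tendsto_rpow_atTop (by positivity)).comp (tendsto_id.atTop_div_const hs)
  filter_upwards [hlim.eventually_ge_atTop 4, eventually_gt_atTop 0] with n hN hn
  set N : ℝ := (n / s) ^ (1 / t : ℝ) with hNdef
  have hNt : N ^ t = n / s := by
    rw [hNdef, ← Real.rpow_natCast, ← Real.rpow_mul (by positivity), one_div,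
      inv_mul_cancel₀ ht0.ne', Real.rpow_one]
  -- Bertrand's postulate supplies a prime between `N / 2` and `N`; `4 ≤ N` makes it odd.
  have hfl : 2 ≤ ⌊N / 2⌋₊ := Nat.le_floor (by push_cast; linarith)
  obtain ⟨p, hp, hpl, hpu⟩ := Nat.exists_prime_lt_and_le_two_mul ⌊N / 2⌋₊ (by omega)
  have hpN : (p : ℝ) ≤ N := by
    have h1 : (p : ℝ) ≤ 2 * ⌊N / 2⌋₊ := by exact_mod_cast hpu
    have h2 := Nat.floor_le (a := N / 2) (by linarith)
    linarith
  have hNp : N / 2 ≤ p := ((Nat.floor_lt (by linarith)).1 hpl).le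
  obtain ⟨G, hGf, hGc⟩ := hG p hp (by omega)
  have hm : ((p ^ t : ℕ) : ℝ) * s ≤ n := by
    rw [← le_div_iff₀ hs, ← hNt]
    push_cast
    gcongr
  have hlow := le_px_stack ht hs hsc hx k hsx hm hGf
  rw [Real.norm_of_nonneg (px_nonneg _ _), Real.norm_of_nonneg (by positivity)]
  have hGc' : (p : ℝ) ^ (2 * t - 1) ≤ 2 * G.card := by exact_mod_cast hGc
  have hNG : N ^ (2 * t - 1) ≤ 2 ^ (2 * t) * G.card := by
    have h1 : (N / 2) ^ (2 * t - 1) ≤ 2 * G.card := le_trans (by gcongr) hGc'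
    rw [div_pow, div_le_iff₀ (by positivity)] at h1
    refine h1.trans (le_of_eq ?_)
    obtain ⟨j, hj⟩ : ∃ j, 2 * t = j + 1 := ⟨2 * t - 1, by omega⟩
    rw [hj, Nat.add_sub_cancel]
    ring
  have hNpow : n ^ (3 - 1 / t : ℝ) = s ^ (2 - 1 / t : ℝ) * n * N ^ (2 * t - 1) := by
    have h1 : N ^ (2 * t - 1) = (n / s) ^ (2 - 1 / t : ℝ) := by
      rw [hNdef, ← Real.rpow_natCast, ← Real.rpow_mul (by positivity)]
      congr 1
      rw [Nat.cast_sub (by omega)]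
      push_cast
      field_simp
    rw [h1, Real.div_rpow hn.le hs.le]
    have h2 : (3 - 1 / t : ℝ) = 1 + (2 - 1 / t) := by ring
    rw [h2, Real.rpow_add hn, Real.rpow_one]
    have h3 : s ^ (2 - 1 / t : ℝ) ≠ 0 := by positivity
    field_simp
  calc n ^ (3 - 1 / t : ℝ) = s ^ (2 - 1 / t : ℝ) * n * N ^ (2 * t - 1) := hNpow
    _ ≤ s ^ (2 - 1 / t : ℝ) * n * (2 ^ (2 * t) * G.card) := by gcongr
    _ = s ^ (2 - 1 / t : ℝ) * 2 ^ (2 * t) / s ^ 2 * (s ^ 2 * n * G.card) := by field_simp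
    _ ≤ _ := by gcongr

theorem isTheta_px_stack {P : Set (Fin 2 → ℝ)} {c : ℝ} (hc : 0 < c)
    (hP : (fun n : ℝ => px n P) =O[atTop] (fun n : ℝ => n)) {t : ℕ} (ht : 1 ≤ t)
    (hG : HasDenseBicliqueFree t) {x : Fin t → Fin 2 → ℝ} (hx : ∀ i, x i ∈ P) (k : Fin 2)
    (hxk : Function.Injective fun i => x i k) :
    (fun n : ℝ => px n (stack P t c)) =Θ[atTop] (fun n : ℝ => n ^ (3 - 1 / t : ℝ)) :=
  ⟨isBigO_px_stack hc hP ht, isBigO_rpow_px_stack hc ht hG hx k hxk⟩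

end PointPattern

theorem mainTheorem12 (P : Set (Fin 2 → ℝ)) (c : ℝ) (hc : 0 < c)
    (hP : (fun n : ℝ => PointPattern.px n P) =O[atTop] (fun n : ℝ => n)) :
    (P.Nontrivial →
      (fun n : ℝ => PointPattern.px n (PointPattern.stack P 2 c))
        =Θ[atTop] (fun n : ℝ => n ^ (5 / 2 : ℝ))) ∧
    ((∃ p ∈ P, ∃ q ∈ P, ∃ r ∈ P, p 0 ≠ q 0 ∧ p 0 ≠ r 0 ∧ q 0 ≠ r 0) →
      (fun n : ℝ => PointPattern.px n (PointPattern.stack P 3 c))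
        =Θ[atTop] (fun n : ℝ => n ^ (8 / 3 : ℝ))) := by
  constructor
  · rintro ⟨p, hp, q, hq, hpq⟩
    -- The cells may cut either planar direction, so a coordinate in which the two points differ
    -- suffices.
    obtain ⟨k, hk⟩ := Function.ne_iff.1 hpq
    have h := PointPattern.isTheta_px_stack hc hP one_le_two
      PointPattern.hasDenseBicliqueFree_two (x := ![p, q])
      (by intro i; fin_cases i <;> simpa) k
      (by intro i j hij; fin_cases i <;> fin_cases j <;> simp_all [eq_comm])
    norm_num at h
    exact h
  · rintro ⟨p, hp, q, hq, r, hr, hpq, hpr, hqr⟩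
    have h := PointPattern.isTheta_px_stack hc hP (t := 3) (by norm_num)
      PointPattern.hasDenseBicliqueFree_three (x := ![p, q, r])
      (by intro i; fin_cases i <;> simpa) 0
      (by intro i j hij; fin_cases i <;> fin_cases j <;> simp_all [eq_comm])
    norm_num at h
    exact h
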